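/- Let $(Y_i)_{i\in\mathbb Z}$ and $(Z_i)_{i\in\mathbb Z}$ be (strictly) stationary sequences of real integrable random variables on a common probability space, with $\mathbb E(Y_1)\neq\mathbb E(Z_1)$, and suppose that each of them satisfies the functional central limit theorem: for $V\in\{Y,Z\}$ there is $\sigma_V>0$ such that $\big\{m^{-1/2}\sum_{i=1}^{\lfloor ms\rfloor}(V_i-\mathbb E V_1)\big\}_{s\in[0,1]}$ converges weakly, as $m\to\infty$, in the space of bounded functions on $[0,1]$ with the uniform metric, to $\sigma_V$ times a standard Brownian motion. Let $c\ge 1$, $k^\star_m=\lfloor mc\rfloor$, and for $i\ge 1$ let $X^{(m)}_i=Y_i$ if $i\le k^\star_m$ and $X^{(m)}_i=Z_i$ otherwise. Let $\bar X^{(m)}_{j:k}=\frac1{k-j+1}\sum_{i=j}^kX^{(m)}_i$ if $j\le k$ and $\bar X^{(m)}_{j:k}=0$ otherwise. For $1\le s\le t$ put $$H_m(s,t)=m^{-3/2}\lfloor ms\rfloor(\lfloor mt\rfloor-\lfloor ms\rfloor)\big(\bar X^{(m)}_{1:\lfloor ms\rfloor}-\bar X^{(m)}_{\lfloor ms\rfloor+1:\lfloor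 mt\rfloor}\big),\qquad K_c(s,t)=(s\wedge c)\{(t\vee c)-(s\vee c)\}\,\Delta\mu,$$ where $\Delta\mu=\mathbb E(Y_1)-\mathbb E(Z_1)$, which equals $\mathbb E(X^{(m)}_{k^\star_m})-\mathbb E(X^{(m)}_{k^\star_m+1})$ for every $m\ge1$. For $k\ge m+1$ let $$S_m(k)=\frac1m\sum_{j=m}^{k-1}\frac{j(k-j)}{m^{3/2}}\big|\bar X^{(m)}_{1:j}-\bar X^{(m)}_{j+1:k}\big|,\qquad T_m(k)=\sqrt{\frac1m\sum_{j=m}^{k-1}\Big\{\frac{j(k-j)}{m^{3/2}}\big(\bar X^{(m)}_{1:j}-\bar X^{(m)}_{j+1:k}\big)\Big\}^2},$$ and for $t\geq 1$ let $w_S(t)=t^{5/2+\eta}w_\gamma(t)$, $w_T(t)=t^{2+\eta}w_\gamma(t)$ with $w_\gamma(t)=\max\{((t-1)/t)^\gamma,\epsilon\}$. Then, for every $T>c$, $\sup_{1\le s\le t\le T}|m^{-1/2}H_m(s,t)-K_c(s,t)|\to0$ in probability as $m\to\infty$. Moreover, for all $\eta\ge0$, $\epsilon\ge0$ and $\gamma\ge0$,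 both $$\sup_{m+1\le k<\infty}\{w_S(k/m)\}^{-1}S_m(k)\quad\text{and}\quad\sup_{m+1\le k<\infty}\{w_T(k/m)\}^{-1}T_m(k),$$ as random variables with values in $[0,\infty]$, diverge to $\infty$ in probability: for every real $M$, the probability that they exceed $M$ tends to $1$ as $m\to\infty$. -/

import Mathlib

open MeasureTheory ProbabilityTheory Filter Topology

noncomputable section

namespace RetroCusum

/-! ### The space of bounded functions, stationarity, and the functional central limit theorem -/

/-- The space of all bounded real-valued functions on `S`, with the uniform norm. -/
abbrev LInf (S : Type*) : Type _ := lp (fun _ : S => ℝ) ⊤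

/-- The space of bounded functions carries the Borel sigma-algebra of the uniform metric. -/
instance instMeasurableSpaceLInf (S : Type*) : MeasurableSpace (LInf S) := borel _

instance instBorelSpaceLInf (S : Type*) : BorelSpace (LInf S) := ⟨rfl⟩

variable {Ω : Type*} [MeasurableSpace Ω]

/-- `(Y_i)`, indexed by the integers, is a (strictly) stationary sequence of real random variables:
the law of the whole sequence is invariant under all shifts of time. -/
structure IsStationary (Y : ℤ → Ω → ℝ) (P : Measure Ω) : Prop where
  measurable : ∀ i, Measurable (Y i)
  shift : ∀ h : ℤ, IdentDistrib (fun ω (i : ℤ) => Y (i + h) ω) (fun ω (i : ℤ) => Y i ω) P P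

/-- `m ^ (-1/2) * ∑_{i=1}^{⌊m s⌋} (Y_i - E Y_1)`. -/
def partialSum (Y : ℤ → Ω → ℝ) (P : Measure Ω) (m : ℕ) (s : ℝ) (ω : Ω) : ℝ :=
  (m : ℝ) ^ (-(1 / 2) : ℝ) * ∑ i ∈ Finset.Icc (1 : ℕ) ⌊(m : ℝ) * s⌋₊, (Y i ω - ∫ ω', Y 1 ω' ∂P)

theorem memℓp_partialSum (Y : ℤ → Ω → ℝ) (P : Measure Ω) (m : ℕ) (ω : Ω) :
    Memℓp (E := fun _ : Set.Icc (0 : ℝ) 1 => ℝ) (fun s => partialSum Y P m s ω) ⊤ := by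
  refine memℓp_infty ⟨(m : ℝ) ^ (-(1 / 2) : ℝ) *
    ∑ i ∈ Finset.Icc (1 : ℕ) m, |Y i ω - ∫ ω', Y 1 ω' ∂P|, ?_⟩
  rintro _ ⟨s, rfl⟩
  have hle : ⌊(m : ℝ) * s⌋₊ ≤ m := by
    refine Nat.floor_le_of_le ?_
    nlinarith [s.2.2, (Nat.cast_nonneg m : (0 : ℝ) ≤ m)]
  have h0 : (0 : ℝ) ≤ (m : ℝ) ^ (-(1 / 2) : ℝ) := by positivity
  simp only [partialSum, norm_mul, Real.norm_eq_abs, abs_of_nonneg h0]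
  refine mul_le_mul_of_nonneg_left ?_ h0
  refine (Finset.abs_sum_le_sum_abs _ _).trans ?_
  exact Finset.sum_le_sum_of_subset_of_nonneg (Finset.Icc_subset_Icc le_rfl hle)
    fun _ _ _ => abs_nonneg _

/-- The partial sum process `{partialSum Y P m s}_{0 ≤ s ≤ 1}` as a random element of the space of
bounded functions on `[0, 1]`. -/
def partialSumProcess (Y : ℤ → Ω → ℝ) (P : Measure Ω) (m : ℕ) (ω : Ω) :
    LInf (Set.Icc (0 : ℝ) 1) :=
  ⟨fun s => partialSum Y P m s ω, memℓp_partialSum Y P m ω⟩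

/-- The functional central limit theorem holds for `(Y_i)`: for some `σ > 0`, the partial sum
processes converge weakly, in the space of bounded functions on `[0, 1]`, to `σ` times a standard
Brownian motion. -/
def SatisfiesFCLT (Y : ℤ → Ω → ℝ) (P : Measure Ω) [IsProbabilityMeasure P] : Prop :=
  ∃ σ : ℝ, 0 < σ ∧
    ∃ (Ω' : Type) (_ : MeasurableSpace Ω') (P' : Measure Ω') (_ : IsProbabilityMeasure P')
      (B : NNReal → Ω' → ℝ) (W : Ω' → LInf (Set.Icc (0 : ℝ) 1)),
      IsBrownianReal B P' ∧
      (∀ᵐ ω' ∂P', ∀ s : Set.Icc (0 : ℝ) 1, W ω' s = σ * B (Real.toNNReal s) ω') ∧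
      TendstoInDistribution (partialSumProcess Y P) atTop W (fun _ => P) P'

/-! ### The data with a change -/

/-- The change point `k*_m = ⌊m c⌋`. -/
def changePoint (c : ℝ) (m : ℕ) : ℕ := ⌊(m : ℝ) * c⌋₊

/-- The observations `X^{(m)}_i`: equal to `Y_i` for `i ≤ k*_m` and to `Z_i` afterwards. -/
def observation (Y Z : ℤ → Ω → ℝ) (c : ℝ) (m : ℕ) (i : ℕ) (ω : Ω) : ℝ :=
  if i ≤ changePoint c m then Y i ω else Z i ω

/-! ### Detectors and threshold functions, for a general sequence of observations -/

/-- The mean `X̄_{j:k}` of `X_j, …, X_k`, equal to `0` if `k < j`. -/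
def mean (X : ℕ → Ω → ℝ) (j k : ℕ) (ω : Ω) : ℝ :=
  if j ≤ k then (1 / ((k : ℝ) - (j : ℝ) + 1)) * ∑ i ∈ Finset.Icc j k, X i ω else 0

/-- `{j (k - j) / m ^ (3/2)} (X̄_{1:j} - X̄_{j+1:k})`. -/
def weightedDiff (X : ℕ → Ω → ℝ) (m j k : ℕ) (ω : Ω) : ℝ :=
  (j : ℝ) * ((k : ℝ) - (j : ℝ)) / (m : ℝ) ^ (3 / 2 : ℝ) * (mean X 1 j ω - mean X (j + 1) k ω)

/-- The detector `S_m(k)`. -/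
def detectorS (X : ℕ → Ω → ℝ) (m k : ℕ) (ω : Ω) : ℝ :=
  (1 / (m : ℝ)) * ∑ j ∈ Finset.Ico m k, |weightedDiff X m j k ω|

/-- The detector `T_m(k)`. -/
def detectorT (X : ℕ → Ω → ℝ) (m k : ℕ) (ω : Ω) : ℝ :=
  Real.sqrt ((1 / (m : ℝ)) * ∑ j ∈ Finset.Ico m k, weightedDiff X m j k ω ^ 2)

/-- The process `H_m(s, t)`. -/
def processH (X : ℕ → Ω → ℝ) (m : ℕ) (s t : ℝ) (ω : Ω) : ℝ :=
  (m : ℝ) ^ (-(3 / 2) : ℝ) * (⌊(m : ℝ) * s⌋₊ : ℝ) *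
    ((⌊(m : ℝ) * t⌋₊ : ℝ) - (⌊(m : ℝ) * s⌋₊ : ℝ)) *
    (mean X 1 ⌊(m : ℝ) * s⌋₊ ω - mean X (⌊(m : ℝ) * s⌋₊ + 1) ⌊(m : ℝ) * t⌋₊ ω)

/-- The limit function `K_c(s, t) = (s ∧ c) {(t ∨ c) - (s ∨ c)} Δμ`. -/
def limitK (c Δμ s t : ℝ) : ℝ := min s c * (max t c - max s c) * Δμ

/-- `w_γ(t) = max {((t - 1) / t) ^ γ, ε}`. -/
def wGamma (γ ε t : ℝ) : ℝ := max (((t - 1) / t) ^ γ) ε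

/-- The threshold function `w_S`. -/
def wS (η γ ε t : ℝ) : ℝ := t ^ (5 / 2 + η) * wGamma γ ε t

/-- The threshold function `w_T`. -/
def wT (η γ ε t : ℝ) : ℝ := t ^ (2 + η) * wGamma γ ε t

/-- `sup_{m+1 ≤ k < ∞} {w_S(k/m)}⁻¹ S_m(k)`, in the extended real line. -/
def supS (X : ℕ → Ω → ℝ) (η γ ε : ℝ) (m : ℕ) (ω : Ω) : EReal :=
  ⨆ k : ℕ, ⨆ _ : m + 1 ≤ k, (((wS η γ ε ((k : ℝ) / m))⁻¹ * detectorS X m k ω : ℝ) : EReal)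

/-- `sup_{m+1 ≤ k < ∞} {w_T(k/m)}⁻¹ T_m(k)`, in the extended real line. -/
def supT (X : ℕ → Ω → ℝ) (η γ ε : ℝ) (m : ℕ) (ω : Ω) : EReal :=
  ⨆ k : ℕ, ⨆ _ : m + 1 ≤ k, (((wT η γ ε ((k : ℝ) / m))⁻¹ * detectorT X m k ω : ℝ) : EReal)

/-! ### Modes of convergence -/

/-- Extended-real random variables `U_m` diverge to `∞` in probability. -/
def DivergesInProbability (U : ℕ → Ω → EReal) (P : Measure Ω) : Prop :=
  ∀ M : ℝ, Tendsto (fun m => P {ω | (M : EReal) < U m ω}) atTop (𝓝 1)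

/-- The random functions `G_m` converge to the function `K` in probability, uniformly on
`{(s, t) : 1 ≤ s ≤ t ≤ T}`. -/
def ConvergesInProbabilityUniformly (G : ℕ → ℝ → ℝ → Ω → ℝ) (K : ℝ → ℝ → ℝ) (T : ℝ)
    (P : Measure Ω) : Prop :=
  ∀ δ : ℝ, 0 < δ → Tendsto (fun m => P {ω | (δ : EReal) <
    ⨆ p : {p : ℝ × ℝ // 1 ≤ p.1 ∧ p.1 ≤ p.2 ∧ p.2 ≤ T},
      ((|G m p.1.1 p.1.2 ω - K p.1.1 p.1.2| : ℝ) : EReal)}) atTop (𝓝 0)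

end RetroCusum

end

/-! With `S_j` the partial sum of the observations up to `j`, the contrast `j (k - j) (X̄_{1:j} -
X̄_{j+1:k})` equals `k S_j - j S_k`, so any part of `S_j` linear in `j` cancels. Here `S_j` is noise
plus `min j k* · Δμ` plus `j · E Z_1`; after division by `m ^ 2` the middle term gives `(t (s ∧ c) -
s (t ∧ c)) Δμ = K_c(s, t)` up to `O(1/m)`. The FCLT enters through tightness of the sup norm,
applied to `Y` and `Z` separately: the noise up to time `N m` is `o(m)`, which gives the uniform
convergence.

For divergence, take the single time `k = ⌊m (c + 2)⌋`. For the `m` indices `m ≤ j < 2m`, `|K_c| ≥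
|Δμ|`, so the weighted differences exceed `m ^ (1/2) |Δμ| / 2` with probability tending to one.
Averaging preserves this order, while the threshold at `k / m ≤ c + 2` stays bounded. -/

namespace RetroCusum

/-! ### Tightness from convergence in distribution -/

section Tightness

/-- A sequence which converges in distribution is bounded in probability. -/
theorem tendsto_measure_norm_gt_of_tendstoInDistribution
    {E Ω Ω' : Type*} [NormedAddCommGroup E] [MeasurableSpace E] [BorelSpace E]
    [MeasurableSpace Ω] [MeasurableSpace Ω'] {P : Measure Ω} [IsProbabilityMeasure P]
    {P' : Measure Ω'} [IsProbabilityMeasure P'] {X : ℕ → Ω → E} {W : Ω' → E}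
    (h : TendstoInDistribution X atTop W (fun _ => P) P') {a : ℕ → ℝ}
    (ha : Tendsto a atTop atTop) :
    Tendsto (fun n => P {ω | a n < ‖X n ω‖}) atTop (𝓝 0) := by
  have hclosed : ∀ A : ℝ, IsClosed {x : E | A ≤ ‖x‖} := fun A =>
    isClosed_le continuous_const continuous_norm
  have htail : Tendsto (fun n : ℕ => (P'.map W) {x | (n : ℝ) ≤ ‖x‖}) atTop (𝓝 0) := by
    have := h.aemeasurable_limit
    have : IsProbabilityMeasure (P'.map W) := Measure.isProbabilityMeasure_map this
    have hI : (⋂ n : ℕ, {x : E | (n : ℝ) ≤ ‖x‖}) = ∅ := by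
      ext x
      simp only [Set.mem_iInter, Set.mem_ofPred_eq, Set.mem_empty_iff_false, iff_false, not_forall,
        not_le]
      exact exists_nat_gt _
    have := tendsto_measure_iInter_atTop (μ := P'.map W)
      (s := fun n : ℕ => {x : E | (n : ℝ) ≤ ‖x‖})
      (fun n => (hclosed n).measurableSet.nullMeasurableSet)
      (fun i j hij x (hx : (j : ℝ) ≤ ‖x‖) => le_trans (Nat.cast_le.2 hij) hx)
      ⟨0, measure_ne_top _ _⟩
    rwa [hI, measure_empty] at this
  rw [ENNReal.tendsto_nhds_zero]
  intro ε hε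
  obtain ⟨A, hA⟩ := ((tendsto_order.1 htail).2 ε hε).exists
  -- Portmanteau on the closed complement of a ball that carries little limit mass.
  have hlim := ProbabilityMeasure.limsup_measure_closed_le_of_tendsto h.tendsto (hclosed A)
  have hev := eventually_lt_of_limsup_lt (hlim.trans_lt hA)
  filter_upwards [hev, ha.eventually_ge_atTop (A : ℝ)] with n hn han
  refine le_trans (measure_mono ?_) ((Measure.le_map_apply (h.forall_aemeasurable n) _).trans hn.le)
  intro ω hω
  exact han.trans (le_of_lt hω)

end Tightness

/-! ### Maximal bounds for centered sums -/

section PartialSums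

variable {Ω : Type*} [MeasurableSpace Ω]

/-- The centered partial sum `∑_{i=1}^k (V_i - E V_1)`. -/
noncomputable def centeredSum (V : ℤ → Ω → ℝ) (P : Measure Ω) (k : ℕ) (ω : Ω) : ℝ :=
  ∑ i ∈ Finset.Icc 1 k, (V i ω - ∫ ω', V 1 ω' ∂P)

/-- Evaluating the level-`n` process at `k / n` recovers the `k`-th sum exactly, so one norm
controls all `k ≤ n`. -/
theorem abs_centeredSum_le (V : ℤ → Ω → ℝ) (P : Measure Ω) {k n : ℕ} (hn : 0 < n) (hk : k ≤ n)
    (ω : Ω) : |centeredSum V P k ω| ≤ (n : ℝ) ^ (1 / 2 : ℝ) * ‖(partialSumProcess V P n ω)‖ := by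
  have hn' : (0 : ℝ) < n := by exact_mod_cast hn
  have hs : (k : ℝ) / n ∈ Set.Icc (0 : ℝ) 1 :=
    ⟨by positivity, (div_le_one hn').2 (by exact_mod_cast hk)⟩
  have h := lp.norm_apply_le_norm ENNReal.top_ne_zero (partialSumProcess V P n ω) ⟨_, hs⟩
  have hval : (partialSumProcess V P n ω) ⟨(k : ℝ) / n, hs⟩
      = (n : ℝ) ^ (-(1 / 2) : ℝ) * centeredSum V P k ω := by
    change partialSum V P n ((k : ℝ) / n) ω = _
    rw [partialSum, mul_div_cancel₀ _ hn'.ne', Nat.floor_natCast, centeredSum]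
  rw [hval, norm_mul, Real.norm_eq_abs, Real.norm_eq_abs,
    abs_of_nonneg (by positivity : (0 : ℝ) ≤ (n : ℝ) ^ (-(1 / 2) : ℝ))] at h
  calc |centeredSum V P k ω|
      = (n : ℝ) ^ (1 / 2 : ℝ) * ((n : ℝ) ^ (-(1 / 2) : ℝ) * |centeredSum V P k ω|) := by
        rw [← mul_assoc, ← Real.rpow_add hn']; norm_num
    _ ≤ _ := by gcongr

/-- Under the functional central limit theorem, the centered partial sums up to time `N m` are
`o(m)` in probability. -/
theorem SatisfiesFCLT.tendsto_measure_centeredSum {V : ℤ → Ω → ℝ} {P : Measure Ω}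
    [IsProbabilityMeasure P] (hV : SatisfiesFCLT V P) {N : ℕ} (hN : 0 < N) {ρ : ℝ} (hρ : 0 < ρ) :
    Tendsto (fun m : ℕ => P {ω | ∃ k ≤ N * m, ρ * m < |centeredSum V P k ω|}) atTop (𝓝 0) := by
  obtain ⟨σ, -, Ω', _, P', _, B, W, -, -, hW⟩ := hV
  have hmul : Tendsto (fun m : ℕ => N * m) atTop atTop :=
    tendsto_id.const_mul_atTop' hN
  -- With `n = N m`, `ρ m = n ^ (1/2) · (ρ / N) n ^ (1/2)`: the norm must exceed a level tending to
  -- infinity.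
  have ha : Tendsto (fun n : ℕ => ρ / N * (n : ℝ) ^ (1 / 2 : ℝ)) atTop atTop :=
    ((tendsto_rpow_atTop (by norm_num)).comp tendsto_natCast_atTop_atTop).const_mul_atTop
      (by positivity)
  have h := (tendsto_measure_norm_gt_of_tendstoInDistribution hW ha).comp hmul
  refine tendsto_of_tendsto_of_tendsto_of_le_of_le' tendsto_const_nhds h
    (Eventually.of_forall fun _ => zero_le) ?_
  filter_upwards [eventually_gt_atTop 0] with m hm
  refine measure_mono ?_
  rintro ω ⟨k, hk, hlt⟩
  have hn : 0 < N * m := Nat.mul_pos hN hm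
  have hn' : (0 : ℝ) < ((N * m : ℕ) : ℝ) := by exact_mod_cast hn
  have hN' : (0 : ℝ) < N := by exact_mod_cast hN
  have hle := hlt.trans_le (abs_centeredSum_le V P hn hk ω)
  have hp : (0 : ℝ) < ((N * m : ℕ) : ℝ) ^ (1 / 2 : ℝ) := by positivity
  change ρ / N * ((N * m : ℕ) : ℝ) ^ (1 / 2 : ℝ) < _
  refine lt_of_mul_lt_mul_left (lt_of_eq_of_lt ?_ hle) hp.le
  have : ((N * m : ℕ) : ℝ) ^ (1 / 2 : ℝ) * ((N * m : ℕ) : ℝ) ^ (1 / 2 : ℝ) = N * m := by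
    rw [← Real.rpow_add hn']; norm_num
  calc _ = ρ / N * (((N * m : ℕ) : ℝ) ^ (1 / 2 : ℝ) * ((N * m : ℕ) : ℝ) ^ (1 / 2 : ℝ)) := by ring
    _ = ρ * m := by rw [this]; field_simp

theorem sum_eq_centeredSum_add (V : ℤ → Ω → ℝ) (P : Measure Ω) (k : ℕ) (ω : Ω) :
    ∑ i ∈ Finset.Icc 1 k, V i ω = centeredSum V P k ω + k * ∫ ω', V 1 ω' ∂P := by
  simp [centeredSum, Finset.sum_sub_distrib]

end PartialSums

/-! ### Algebra of the contrast and floor errors -/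

section Observations

variable {Ω : Type*}

/-- All sums start at 1, so that the maximal bounds apply to each. -/
theorem sum_observation (Y Z : ℤ → Ω → ℝ) (c : ℝ) (m j : ℕ) (ω : Ω) :
    ∑ i ∈ Finset.Icc 1 j, observation Y Z c m i ω =
      ∑ i ∈ Finset.Icc 1 (min j (changePoint c m)), Y i ω +
        (∑ i ∈ Finset.Icc 1 j, Z i ω -
          ∑ i ∈ Finset.Icc 1 (min j (changePoint c m)), Z i ω) := by
  have hf : Finset.Icc 1 (min j (changePoint c m)) =
      (Finset.Icc 1 j).filter (· ≤ changePoint c m) := by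
    ext i
    simp only [Finset.mem_Icc, Finset.mem_filter, le_min_iff]
    tauto
  rw [hf, Finset.sum_filter, Finset.sum_filter, ← Finset.sum_sub_distrib, ← Finset.sum_add_distrib]
  refine Finset.sum_congr rfl fun i _ => ?_
  by_cases h : i ≤ changePoint c m <;> simp [observation, h]

/-- The factors `j` and `k - j` clear the denominators, and vanish when the corresponding mean is
empty. -/
theorem mul_mul_mean_sub_mean (X : ℕ → Ω → ℝ) {j k : ℕ} (hjk : j ≤ k) (ω : Ω) :
    (j : ℝ) * ((k : ℝ) - j) * (mean X 1 j ω - mean X (j + 1) k ω) =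
      k * ∑ i ∈ Finset.Icc 1 j, X i ω - j * ∑ i ∈ Finset.Icc 1 k, X i ω := by
  have h1 : (j : ℝ) * mean X 1 j ω = ∑ i ∈ Finset.Icc 1 j, X i ω := by
    rcases Nat.eq_zero_or_pos j with rfl | hj
    · simp
    · have : (j : ℝ) ≠ 0 := by positivity
      rw [mean, if_pos (show 1 ≤ j from hj)]
      rw [Nat.cast_one, sub_add_cancel, ← mul_assoc, mul_one_div_cancel this, one_mul]
  have h2 : ((k : ℝ) - j) * mean X (j + 1) k ω =
      ∑ i ∈ Finset.Icc 1 k, X i ω - ∑ i ∈ Finset.Icc 1 j, X i ω := by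
    rcases hjk.eq_or_lt with rfl | hlt
    · simp
    · have hpos : (0 : ℝ) < (k : ℝ) - j := sub_pos.2 (by exact_mod_cast hlt)
      have hsum : ∑ i ∈ Finset.Icc 1 k, X i ω =
          ∑ i ∈ Finset.Icc 1 j, X i ω + ∑ i ∈ Finset.Icc (j + 1) k, X i ω := by
        rw [← Finset.sum_union]
        · congr 1
          ext i
          simp only [Finset.mem_union, Finset.mem_Icc]
          omega
        · rw [Finset.disjoint_left]
          intro i
          simp only [Finset.mem_Icc]
          omega
      rw [mean, if_pos (show j + 1 ≤ k from hlt), hsum]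
      push_cast
      rw [show (k : ℝ) - (j + 1) + 1 = k - j by ring]
      field_simp
      ring
  linear_combination ((k : ℝ) - j) * h1 - (j : ℝ) * h2

theorem rpow_mul_processH (X : ℕ → Ω → ℝ) {m : ℕ} (hm : 0 < m) {s t : ℝ} (hst : s ≤ t) (ω : Ω) :
    (m : ℝ) ^ (-(1 / 2) : ℝ) * processH X m s t ω =
      (⌊(m : ℝ) * t⌋₊ * ∑ i ∈ Finset.Icc 1 ⌊(m : ℝ) * s⌋₊, X i ω -
        ⌊(m : ℝ) * s⌋₊ * ∑ i ∈ Finset.Icc 1 ⌊(m : ℝ) * t⌋₊, X i ω) / (m : ℝ) ^ 2 := by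
  have hm' : (0 : ℝ) < m := by exact_mod_cast hm
  have hjk : ⌊(m : ℝ) * s⌋₊ ≤ ⌊(m : ℝ) * t⌋₊ := Nat.floor_mono (by gcongr)
  rw [← mul_mul_mean_sub_mean X hjk, processH]
  have : (m : ℝ) ^ (-(1 / 2) : ℝ) * (m : ℝ) ^ (-(3 / 2) : ℝ) = ((m : ℝ) ^ 2)⁻¹ := by
    rw [← Real.rpow_add hm', ← Real.rpow_natCast, ← Real.rpow_neg hm'.le]; norm_num
  rw [div_eq_mul_inv _ ((m : ℝ) ^ 2), ← this]
  ring

/-- The continuous analogue of `k S_j - j S_k`, with drift `min · c`. -/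
theorem limitK_eq {c Δμ s t : ℝ} (hst : s ≤ t) :
    limitK c Δμ s t = (t * min s c - s * min t c) * Δμ := by
  rw [limitK]
  congr 1
  rcases le_total s c with h1 | h1 <;> rcases le_total t c with h2 | h2
  · rw [min_eq_left h1, min_eq_left h2, max_eq_right h1, max_eq_right h2]; ring
  · rw [min_eq_left h1, min_eq_right h2, max_eq_right h1, max_eq_left h2]; ring
  · obtain rfl : s = c := le_antisymm (hst.trans h2) h1
    obtain rfl : s = t := le_antisymm hst h2
    simp
  · rw [min_eq_right h1, min_eq_right h2, max_eq_left h1, max_eq_left h2]; ring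

theorem abs_floor_div_sub_le {m : ℕ} (hm : 0 < m) {t : ℝ} (ht : 0 ≤ t) :
    |(⌊(m : ℝ) * t⌋₊ : ℝ) / m - t| ≤ 1 / m := by
  have hm' : (0 : ℝ) < m := by exact_mod_cast hm
  have h1 := Nat.floor_le (show 0 ≤ (m : ℝ) * t by positivity)
  have h2 := Nat.lt_floor_add_one ((m : ℝ) * t)
  rw [show (⌊(m : ℝ) * t⌋₊ : ℝ) / m - t = (⌊(m : ℝ) * t⌋₊ - m * t) / m by field_simp,
    abs_div, abs_of_pos hm']
  gcongr
  rw [abs_le]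
  constructor <;> linarith

theorem abs_floor_mul_min_sub_le {m : ℕ} (hm : 0 < m) {c s t T : ℝ} (hc : 0 ≤ c) (hs : 0 ≤ s)
    (ht : 0 ≤ t) (hsT : s ≤ T) (htT : t ≤ T) :
    |(⌊(m : ℝ) * t⌋₊ : ℝ) * (min ⌊(m : ℝ) * s⌋₊ (changePoint c m) : ℕ) / (m : ℝ) ^ 2 -
      t * min s c| ≤ 2 * T / m := by
  have hm' : (0 : ℝ) < m := by exact_mod_cast hm
  set u : ℝ := (⌊(m : ℝ) * t⌋₊ : ℝ) / m with hu
  set v : ℝ := ((min ⌊(m : ℝ) * s⌋₊ (changePoint c m) : ℕ) : ℝ) / m with hv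
  have hut : |u - t| ≤ 1 / m := abs_floor_div_sub_le hm ht
  have huT : |u| ≤ T := by
    rw [abs_of_nonneg (by positivity), hu, div_le_iff₀ hm']
    refine (Nat.floor_le (by positivity)).trans ?_
    rw [mul_comm]
    gcongr
  have hvv : |v - min s c| ≤ 1 / m := by
    have : v = min ((⌊(m : ℝ) * s⌋₊ : ℝ) / m) ((⌊(m : ℝ) * c⌋₊ : ℝ) / m) := by
      rw [hv, changePoint, Nat.cast_min, min_div_div_right hm'.le]
    rw [this]
    exact (abs_min_sub_min_le_max _ _ _ _).trans
      (max_le (abs_floor_div_sub_le hm hs) (abs_floor_div_sub_le hm hc))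
  have hmin : |min s c| ≤ T := by
    rw [abs_of_nonneg (le_min hs hc)]
    exact (min_le_left _ _).trans hsT
  have : (⌊(m : ℝ) * t⌋₊ : ℝ) * (min ⌊(m : ℝ) * s⌋₊ (changePoint c m) : ℕ) / (m : ℝ) ^ 2 -
      t * min s c = u * (v - min s c) + min s c * (u - t) := by
    rw [hu, hv]
    field_simp
    ring
  rw [this]
  calc _ ≤ |u| * |v - min s c| + |min s c| * |u - t| := by
        rw [← abs_mul, ← abs_mul]
        exact abs_add_le _ _
    _ ≤ T * (1 / m) + T * (1 / m) := by gcongr <;> exact (abs_nonneg _).trans huT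
    _ = _ := by ring

end Observations

/-! ### Uniform convergence to the limit -/

section Uniform

variable {Ω : Type*} [MeasurableSpace Ω]

/-- Deterministic comparison of the process `m ^ (-1/2) H_m` with its limit, on the event that the
centered partial sums are bounded by `D`. -/
theorem abs_processH_sub_limitK_le {Y Z : ℤ → Ω → ℝ} {P : Measure Ω} {c D T s t : ℝ} {m N : ℕ}
    (hm : 0 < m) (hc : 0 ≤ c) (hN : T ≤ N) {ω : Ω}
    (hY : ∀ k ≤ N * m, |centeredSum Y P k ω| ≤ D) (hZ : ∀ k ≤ N * m, |centeredSum Z P k ω| ≤ D)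
    (hs : 0 ≤ s) (hst : s ≤ t) (htT : t ≤ T) :
    |(m : ℝ) ^ (-(1 / 2) : ℝ) * processH (observation Y Z c m) m s t ω -
        limitK c ((∫ ω, Y 1 ω ∂P) - ∫ ω, Z 1 ω ∂P) s t| ≤
      4 * T * |(∫ ω, Y 1 ω ∂P) - ∫ ω, Z 1 ω ∂P| / m + 6 * T * D / m := by
  have hm' : (0 : ℝ) < m := by exact_mod_cast hm
  have ht := hs.trans hst
  have hT := ht.trans htT
  have hD : 0 ≤ D := (abs_nonneg _).trans (hY 0 (Nat.zero_le _))
  set Δμ := (∫ ω, Y 1 ω ∂P) - ∫ ω, Z 1 ω ∂P with hΔ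
  set e : ℕ → ℝ := fun j => centeredSum Y P (min j (changePoint c m)) ω +
    (centeredSum Z P j ω - centeredSum Z P (min j (changePoint c m)) ω) with he
  have hsum : ∀ j : ℕ, ∑ i ∈ Finset.Icc 1 j, observation Y Z c m i ω =
      e j + (min j (changePoint c m) : ℕ) * Δμ + j * ∫ ω, Z 1 ω ∂P := by
    intro j
    rw [sum_observation, sum_eq_centeredSum_add Y P, sum_eq_centeredSum_add Z P,
      sum_eq_centeredSum_add Z P, he, hΔ]
    ring
  -- The noise `e j` consists of three centered sums, each at most `D`.
  have hebound : ∀ j ≤ N * m, |e j| ≤ 3 * D := by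
    intro j hj
    have h1 := hY _ ((min_le_left j (changePoint c m)).trans hj)
    have h2 := hZ _ hj
    have h3 := hZ _ ((min_le_left j (changePoint c m)).trans hj)
    rw [abs_le] at *
    constructor <;> simp only [he] <;> linarith
  have hfloor : ∀ x : ℝ, 0 ≤ x → x ≤ T → (⌊(m : ℝ) * x⌋₊ : ℝ) / m ≤ T := by
    intro x hx hxT
    rw [div_le_iff₀ hm']
    refine (Nat.floor_le (by positivity)).trans ?_
    rw [mul_comm]
    gcongr
  have hfloorN : ∀ x : ℝ, 0 ≤ x → x ≤ T → ⌊(m : ℝ) * x⌋₊ ≤ N * m := by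
    intro x hx hxT
    refine Nat.floor_le_of_le ?_
    push_cast
    rw [mul_comm]
    gcongr
    exact hxT.trans hN
  have h1 := abs_floor_mul_min_sub_le hm hc hs ht (hst.trans htT) htT
  have h2 := abs_floor_mul_min_sub_le hm hc ht hs htT (hst.trans htT)
  rw [rpow_mul_processH _ hm hst, limitK_eq hst, hsum, hsum]
  set j := ⌊(m : ℝ) * s⌋₊
  set k := ⌊(m : ℝ) * t⌋₊
  set a := (k : ℝ) * (min j (changePoint c m) : ℕ) / (m : ℝ) ^ 2 - t * min s c
  set b := (j : ℝ) * (min k (changePoint c m) : ℕ) / (m : ℝ) ^ 2 - s * min t c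
  have hj : |(j : ℝ) / m * (e k / m)| ≤ T * (3 * D / m) := by
    rw [abs_mul, abs_div (e k), abs_of_pos hm', abs_of_nonneg (by positivity)]
    gcongr
    · exact hfloor s hs (hst.trans htT)
    · exact hebound _ (hfloorN t ht htT)
  have hk : |(k : ℝ) / m * (e j / m)| ≤ T * (3 * D / m) := by
    rw [abs_mul, abs_div (e j), abs_of_pos hm', abs_of_nonneg (by positivity)]
    gcongr
    · exact hfloor t ht htT
    · exact hebound _ (hfloorN s hs (hst.trans htT))
  have hab : |(a - b) * Δμ| ≤ (2 * T / m + 2 * T / m) * |Δμ| := by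
    rw [abs_mul]
    gcongr
    exact (abs_sub _ _).trans (add_le_add h1 h2)
  -- The `E Z_1` terms cancel; only floor errors and noise remain.
  have hsplit : (k * (e j + (min j (changePoint c m) : ℕ) * Δμ + j * ∫ ω, Z 1 ω ∂P) -
      j * (e k + (min k (changePoint c m) : ℕ) * Δμ + k * ∫ ω, Z 1 ω ∂P)) / (m : ℝ) ^ 2 -
      (t * min s c - s * min t c) * Δμ =
      (a - b) * Δμ + ((k : ℝ) / m * (e j / m) - (j : ℝ) / m * (e k / m)) := by
    simp only [a, b]
    field_simp
    ring
  rw [hsplit]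
  calc _ ≤ |(a - b) * Δμ| + (|(k : ℝ) / m * (e j / m)| + |(j : ℝ) / m * (e k / m)|) :=
        (abs_add_le _ _).trans (add_le_add le_rfl (abs_sub _ _))
    _ ≤ (2 * T / m + 2 * T / m) * |Δμ| + (T * (3 * D / m) + T * (3 * D / m)) := by gcongr
    _ = _ := by ring

theorem convergesInProbabilityUniformly_processH {Y Z : ℤ → Ω → ℝ} {P : Measure Ω}
    [IsProbabilityMeasure P] {c : ℝ} (hc : 0 ≤ c) (hY : SatisfiesFCLT Y P)
    (hZ : SatisfiesFCLT Z P) {T : ℝ} (hT : 0 < T) :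
    ConvergesInProbabilityUniformly
      (fun m s t ω => (m : ℝ) ^ (-(1 / 2) : ℝ) * processH (observation Y Z c m) m s t ω)
      (limitK c ((∫ ω, Y 1 ω ∂P) - ∫ ω, Z 1 ω ∂P)) T P := by
  intro δ hδ
  set Δμ := (∫ ω, Y 1 ω ∂P) - ∫ ω, Z 1 ω ∂P
  set N := ⌈T⌉₊
  have hN : 0 < N := Nat.ceil_pos.2 hT
  -- Chosen so that the noise term `6 T (ρ m) / m` is `δ / 2`.
  set ρ := δ / (12 * T) with hρ_def
  have hρ : 0 < ρ := by positivity
  have hlim := (hY.tendsto_measure_centeredSum hN hρ).add (hZ.tendsto_measure_centeredSum hN hρ)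
  rw [add_zero] at hlim
  have hsmall : Tendsto (fun m : ℕ => 4 * T * |Δμ| / (m : ℝ)) atTop (𝓝 0) :=
    tendsto_const_nhds.div_atTop tendsto_natCast_atTop_atTop
  refine tendsto_of_tendsto_of_tendsto_of_le_of_le' tendsto_const_nhds hlim
    (Eventually.of_forall fun _ => zero_le) ?_
  filter_upwards [eventually_gt_atTop 0, (tendsto_order.1 hsmall).2 (δ / 2) (by positivity)]
    with m hm hmδ
  refine (measure_mono ?_).trans (measure_union_le _ _)
  intro ω hω
  by_contra hcon
  simp only [Set.mem_union, Set.mem_ofPred_eq, not_or, not_exists, not_and, not_lt] at hcon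
  refine absurd hω (not_lt.2 (iSup_le fun p => EReal.coe_le_coe_iff.2 ?_))
  obtain ⟨⟨s, t⟩, hs, hst, ht⟩ := p
  refine (abs_processH_sub_limitK_le hm hc (Nat.le_ceil T) hcon.1 hcon.2
    (zero_le_one.trans hs) hst ht).trans ?_
  have hm' : (0 : ℝ) < m := by exact_mod_cast hm
  have : 6 * T * (ρ * m) / m = δ / 2 := by
    rw [hρ_def]
    field_simp
    norm_num
  rw [this]
  linarith

end Uniform

/-! ### Lower bounds for detectors, upper bounds for thresholds -/

section Detectors

variable {Ω : Type*}

/-- At `s = j / m` the floor is exact; the factor `m ^ (1/2)` is what diverges. -/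
theorem weightedDiff_eq_processH (X : ℕ → Ω → ℝ) {m : ℕ} (hm : 0 < m) (j : ℕ) (t : ℝ) (ω : Ω) :
    weightedDiff X m j ⌊(m : ℝ) * t⌋₊ ω =
      (m : ℝ) ^ (1 / 2 : ℝ) * ((m : ℝ) ^ (-(1 / 2) : ℝ) * processH X m ((j : ℝ) / m) t ω) := by
  have hm' : (0 : ℝ) < m := by exact_mod_cast hm
  rw [← mul_assoc, ← Real.rpow_add hm', weightedDiff, processH, mul_div_cancel₀ _ hm'.ne',
    Nat.floor_natCast, Real.rpow_neg hm'.le (3 / 2), add_neg_cancel, Real.rpow_zero]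
  ring

/-- Ending at `c + 2` leaves a gap of at least 1 after `max s c ≤ c + 1`. -/
theorem le_limitK_abs {c Δμ s : ℝ} (hc : 1 ≤ c) (hs : 1 ≤ s) (hsc : s ≤ c + 1) :
    |Δμ| ≤ |limitK c Δμ s (c + 2)| := by
  rw [limitK, abs_mul]
  have h1 : 1 ≤ min s c := le_min hs hc
  have h2 : 1 ≤ max (c + 2) c - max s c := by
    rw [max_eq_left (by linarith : c ≤ c + 2)]
    have : max s c ≤ c + 1 := max_le hsc (by linarith)
    linarith
  have h3 : 1 ≤ |min s c * (max (c + 2) c - max s c)| :=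
    (one_le_mul_of_one_le_of_one_le h1 h2).trans (le_abs_self _)
  exact le_mul_of_one_le_left (abs_nonneg _) h3

/-- The block `[m, 2m)` has exactly `m` terms, offsetting the factor `1 / m`. -/
theorem le_detectorS {X : ℕ → Ω → ℝ} {m k : ℕ} {ω : Ω} {b : ℝ} (hm : 0 < m) (hk : 2 * m ≤ k)
    (h : ∀ j ∈ Finset.Ico m (2 * m), b ≤ |weightedDiff X m j k ω|) :
    b ≤ detectorS X m k ω := by
  have hm' : (0 : ℝ) < m := by exact_mod_cast hm
  have h1 := Finset.card_nsmul_le_sum _ _ _ h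
  have h2 : ∑ j ∈ Finset.Ico m (2 * m), |weightedDiff X m j k ω| ≤
      ∑ j ∈ Finset.Ico m k, |weightedDiff X m j k ω| :=
    Finset.sum_le_sum_of_subset_of_nonneg (Finset.Ico_subset_Ico le_rfl hk)
      fun _ _ _ => abs_nonneg _
  rw [Nat.card_Ico, show 2 * m - m = m by omega, nsmul_eq_mul] at h1
  rw [detectorS, one_div, le_inv_mul_iff₀ hm']
  exact h1.trans h2

theorem le_detectorT {X : ℕ → Ω → ℝ} {m k : ℕ} {ω : Ω} {b : ℝ} (hm : 0 < m) (hk : 2 * m ≤ k)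
    (hb : 0 ≤ b) (h : ∀ j ∈ Finset.Ico m (2 * m), b ≤ |weightedDiff X m j k ω|) :
    b ≤ detectorT X m k ω := by
  have hm' : (0 : ℝ) < m := by exact_mod_cast hm
  have h1 := Finset.card_nsmul_le_sum (Finset.Ico m (2 * m))
    (fun j => weightedDiff X m j k ω ^ 2) (b ^ 2) fun j hj => by
      rw [← sq_abs (weightedDiff X m j k ω)]
      exact pow_le_pow_left₀ hb (h j hj) 2
  have h2 : ∑ j ∈ Finset.Ico m (2 * m), weightedDiff X m j k ω ^ 2 ≤
      ∑ j ∈ Finset.Ico m k, weightedDiff X m j k ω ^ 2 :=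
    Finset.sum_le_sum_of_subset_of_nonneg (Finset.Ico_subset_Ico le_rfl hk)
      fun _ _ _ => sq_nonneg _
  rw [Nat.card_Ico, show 2 * m - m = m by omega, nsmul_eq_mul] at h1
  refine Real.le_sqrt_of_sq_le ?_
  rw [one_div, le_inv_mul_iff₀ hm']
  exact h1.trans h2

/-- Strict `1 < t` keeps the weight positive even when `ε = 0`, so its inverse is genuine. -/
theorem rpow_mul_wGamma_pos {p γ ε t : ℝ} (ht : 1 < t) : 0 < t ^ p * wGamma γ ε t := by
  have h0 : 0 < t := by linarith
  exact mul_pos (Real.rpow_pos_of_pos h0 _)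
    (lt_max_of_lt_left (Real.rpow_pos_of_pos (div_pos (by linarith) h0) _))

theorem rpow_mul_wGamma_le {p γ ε t T : ℝ} (hp : 0 ≤ p) (hγ : 0 ≤ γ) (ht : 1 < t) (htT : t ≤ T) :
    t ^ p * wGamma γ ε t ≤ T ^ p * max 1 ε := by
  have h0 : 0 < t := by linarith
  have h1 : ((t - 1) / t) ^ γ ≤ 1 :=
    Real.rpow_le_one (div_nonneg (by linarith) h0.le) ((div_le_one h0).2 (by linarith)) hγ
  exact mul_le_mul (Real.rpow_le_rpow h0.le htT hp) (max_le_max h1 le_rfl)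
    (le_max_of_le_left (Real.rpow_nonneg (div_nonneg (by linarith) h0.le) _))
    (Real.rpow_nonneg (h0.le.trans htT) _)

end Detectors

/-! ### Divergence in probability -/

section Divergence

variable {Ω : Type*} [MeasurableSpace Ω]

/-- With probability tending to one, all the weighted differences at the monitoring time
`⌊m (c + 2)⌋` and at times `m ≤ j < 2 m` are at least of the order `m ^ (1/2)`. -/
theorem tendsto_measure_exists_weightedDiff_lt {Y Z : ℤ → Ω → ℝ} {P : Measure Ω}
    [IsProbabilityMeasure P] {c : ℝ} (hc : 1 ≤ c)
    (hmean : ∫ ω, Y 1 ω ∂P ≠ ∫ ω, Z 1 ω ∂P) (hY : SatisfiesFCLT Y P) (hZ : SatisfiesFCLT Z P) :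
    Tendsto (fun m : ℕ => P {ω | ∃ j ∈ Finset.Ico m (2 * m),
      |weightedDiff (observation Y Z c m) m j ⌊(m : ℝ) * (c + 2)⌋₊ ω| <
        (m : ℝ) ^ (1 / 2 : ℝ) * (|(∫ ω, Y 1 ω ∂P) - ∫ ω, Z 1 ω ∂P| / 2)}) atTop (𝓝 0) := by
  set Δμ := (∫ ω, Y 1 ω ∂P) - ∫ ω, Z 1 ω ∂P
  have hΔ : 0 < |Δμ| := abs_pos.2 (sub_ne_zero.2 hmean)
  have h := convergesInProbabilityUniformly_processH (by linarith : 0 ≤ c) hY hZ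
    (by linarith : 0 < c + 2) (|Δμ| / 2) (by positivity)
  refine tendsto_of_tendsto_of_tendsto_of_le_of_le' tendsto_const_nhds h
    (Eventually.of_forall fun _ => zero_le) ?_
  filter_upwards [eventually_gt_atTop 0] with m hm
  have hm' : (0 : ℝ) < m := by exact_mod_cast hm
  refine measure_mono ?_
  rintro ω ⟨j, hj, hlt⟩
  rw [Finset.mem_Ico] at hj
  have hs : 1 ≤ (j : ℝ) / m := (one_le_div hm').2 (by exact_mod_cast hj.1)
  have hs2 : (j : ℝ) / m ≤ 2 := (div_le_iff₀ hm').2 (by exact_mod_cast hj.2.le)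
  rw [weightedDiff_eq_processH _ hm, abs_mul, abs_of_nonneg (by positivity)] at hlt
  have hlt' := lt_of_mul_lt_mul_left hlt (by positivity)
  have hK := le_limitK_abs (Δμ := Δμ) hc hs (by linarith)
  refine lt_of_lt_of_le (EReal.coe_lt_coe_iff.2 ?_) (le_iSup
    (fun p : {p : ℝ × ℝ // 1 ≤ p.1 ∧ p.1 ≤ p.2 ∧ p.2 ≤ c + 2} =>
      ((|(m : ℝ) ^ (-(1 / 2) : ℝ) * processH (observation Y Z c m) m p.1.1 p.1.2 ω -
        limitK c Δμ p.1.1 p.1.2| : ℝ) : EReal))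
    ⟨((j : ℝ) / m, c + 2), hs, by dsimp only; linarith, le_rfl⟩)
  have := abs_sub_abs_le_abs_sub (limitK c Δμ ((j : ℝ) / m) (c + 2))
    ((m : ℝ) ^ (-(1 / 2) : ℝ) * processH (observation Y Z c m) m ((j : ℝ) / m) (c + 2) ω)
  rw [abs_sub_comm] at this
  dsimp only
  linarith

/-- A weighted detector diverges in probability as soon as it dominates `m ^ (1/2) b` whenever the
weighted differences do. -/
theorem divergesInProbability_of_detector {Y Z : ℤ → Ω → ℝ} {P : Measure Ω}
    [IsProbabilityMeasure P] {c : ℝ} (hc : 1 ≤ c)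
    (hmean : ∫ ω, Y 1 ω ∂P ≠ ∫ ω, Z 1 ω ∂P) (hY : SatisfiesFCLT Y P) (hZ : SatisfiesFCLT Z P)
    {p γ ε : ℝ} (hp : 0 ≤ p) (hγ : 0 ≤ γ) (D : ℕ → ℕ → Ω → ℝ)
    (hD : ∀ m k ω b, 0 < m → 2 * m ≤ k → 0 ≤ b → (∀ j ∈ Finset.Ico m (2 * m),
      b ≤ |weightedDiff (observation Y Z c m) m j k ω|) → b ≤ D m k ω) :
    DivergesInProbability (fun m ω => ⨆ k : ℕ, ⨆ _ : m + 1 ≤ k,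
      (((((k : ℝ) / m) ^ p * wGamma γ ε ((k : ℝ) / m))⁻¹ * D m k ω : ℝ) : EReal)) P := by
  intro M
  set Δμ := (∫ ω, Y 1 ω ∂P) - ∫ ω, Z 1 ω ∂P
  have hΔ : 0 < |Δμ| := abs_pos.2 (sub_ne_zero.2 hmean)
  set C : ℝ := (c + 2) ^ p * max 1 ε with hC
  have hCpos : 0 < C :=
    mul_pos (Real.rpow_pos_of_pos (by linarith) _) (lt_max_of_lt_left one_pos)
  have hbad := tendsto_measure_exists_weightedDiff_lt hc hmean hY hZ
  have hgrow : Tendsto (fun m : ℕ => C⁻¹ * ((m : ℝ) ^ (1 / 2 : ℝ) * (|Δμ| / 2))) atTop atTop :=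
    (((tendsto_rpow_atTop (by norm_num)).comp tendsto_natCast_atTop_atTop).atTop_mul_const
      (by positivity)).const_mul_atTop (by positivity)
  have hlow := ENNReal.Tendsto.sub (tendsto_const_nhds (x := (1 : ENNReal))) hbad (by simp)
  rw [tsub_zero] at hlow
  refine tendsto_of_tendsto_of_tendsto_of_le_of_le' hlow tendsto_const_nhds ?_
    (Eventually.of_forall fun _ => prob_le_one)
  filter_upwards [eventually_gt_atTop 0, hgrow.eventually_gt_atTop M] with m hm hmM
  have hm' : (0 : ℝ) < m := by exact_mod_cast hm
  -- Covering the whole space by the good and bad events needs only subadditivity, not measurability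
  -- of the supremum.
  rw [tsub_le_iff_right, ← measure_univ (μ := P)]
  refine (measure_mono ?_).trans (measure_union_le _ _)
  intro ω _
  by_cases hω : ∃ j ∈ Finset.Ico m (2 * m),
      |weightedDiff (observation Y Z c m) m j ⌊(m : ℝ) * (c + 2)⌋₊ ω| <
        (m : ℝ) ^ (1 / 2 : ℝ) * (|Δμ| / 2)
  · exact Or.inr hω
  left
  push Not at hω
  set k := ⌊(m : ℝ) * (c + 2)⌋₊ with hk_def
  have hk : 2 * m ≤ k := Nat.le_floor (by push_cast; nlinarith)
  have hmk : m + 1 ≤ k := by omega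
  have hk1 : 1 < (k : ℝ) / m := (one_lt_div hm').2 (by exact_mod_cast hmk)
  have hk2 : (k : ℝ) / m ≤ c + 2 := by
    rw [div_le_iff₀ hm', mul_comm]
    exact Nat.floor_le (by nlinarith)
  have hDk := hD m k ω _ hm hk (by positivity) hω
  refine lt_of_lt_of_le (EReal.coe_lt_coe_iff.2 (hmM.trans_le ?_))
    (le_iSup₂ (f := fun (k : ℕ) (_ : m + 1 ≤ k) =>
      (((((k : ℝ) / m) ^ p * wGamma γ ε ((k : ℝ) / m))⁻¹ * D m k ω : ℝ) : EReal)) k hmk)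
  have hw := rpow_mul_wGamma_pos (p := p) (γ := γ) (ε := ε) hk1
  exact mul_le_mul (inv_anti₀ hw (rpow_mul_wGamma_le hp hγ hk1 hk2)) hDk (by positivity)
    (inv_nonneg.2 hw.le)

end Divergence

/-! ### Constancy of the means -/

section Stationarity

variable {Ω : Type*} [MeasurableSpace Ω]

theorem IsStationary.integral_eq {Y : ℤ → Ω → ℝ} {P : Measure Ω} (hY : IsStationary Y P) (i : ℤ) :
    ∫ ω, Y i ω ∂P = ∫ ω, Y 1 ω ∂P := by
  have h := ((hY.shift (i - 1)).comp (measurable_pi_apply (1 : ℤ))).integral_eq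
  simpa [Function.comp_def] using h

end Stationarity

end RetroCusum

theorem theorem3 {Ω : Type*} [MeasurableSpace Ω] (P : Measure Ω) [IsProbabilityMeasure P]
    (Y Z : ℤ → Ω → ℝ) (c : ℝ) (hc : 1 ≤ c)
    (hYstat : RetroCusum.IsStationary Y P) (hZstat : RetroCusum.IsStationary Z P)
    (hYint : Integrable (Y 1) P) (hZint : Integrable (Z 1) P)
    (hmean : ∫ ω, Y 1 ω ∂P ≠ ∫ ω, Z 1 ω ∂P)
    (hYfclt : RetroCusum.SatisfiesFCLT Y P) (hZfclt : RetroCusum.SatisfiesFCLT Z P) :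
    (∀ m : ℕ, 1 ≤ m →
      (∫ ω, RetroCusum.observation Y Z c m (RetroCusum.changePoint c m) ω ∂P) -
        (∫ ω, RetroCusum.observation Y Z c m (RetroCusum.changePoint c m + 1) ω ∂P) =
      (∫ ω, Y 1 ω ∂P) - ∫ ω, Z 1 ω ∂P) ∧
    (∀ T : ℝ, c < T →
      RetroCusum.ConvergesInProbabilityUniformly
        (fun m s t ω => (m : ℝ) ^ (-(1 / 2) : ℝ) *
          RetroCusum.processH (RetroCusum.observation Y Z c m) m s t ω)
        (RetroCusum.limitK c ((∫ ω, Y 1 ω ∂P) - ∫ ω, Z 1 ω ∂P)) T P) ∧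
    (∀ η ε γ : ℝ, 0 ≤ η → 0 ≤ ε → 0 ≤ γ →
      RetroCusum.DivergesInProbability
        (fun m => RetroCusum.supS (RetroCusum.observation Y Z c m) η γ ε m) P ∧
      RetroCusum.DivergesInProbability
        (fun m => RetroCusum.supT (RetroCusum.observation Y Z c m) η γ ε m) P) := by
  refine ⟨fun m hm => ?_, fun T hT => ?_, fun η ε γ hη _ hγ => ⟨?_, ?_⟩⟩
  · simp only [RetroCusum.observation, le_refl, if_true, if_neg (Nat.not_succ_le_self _)]
    rw [hYstat.integral_eq, hZstat.integral_eq]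
  · exact RetroCusum.convergesInProbabilityUniformly_processH (by linarith) hYfclt hZfclt
      (by linarith)
  · exact RetroCusum.divergesInProbability_of_detector hc hmean hYfclt hZfclt
      (by linarith : (0 : ℝ) ≤ 5 / 2 + η) hγ
      (fun m k ω => RetroCusum.detectorS (RetroCusum.observation Y Z c m) m k ω)
      fun m k ω b hm hk _ h => RetroCusum.le_detectorS hm hk h
  · exact RetroCusum.divergesInProbability_of_detector hc hmean hYfclt hZfclt
      (by linarith : (0 : ℝ) ≤ 2 + η) hγ
      (fun m k ω => RetroCusum.detectorT (RetroCusum.observation Y Z c m) m k ω)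
      fun m k ω b hm hk hb h => RetroCusum.le_detectorT hm hk hb h
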